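/- Let $H$ be a complex Hilbert space (not necessarily separable), let $\{T_t\}_{t\ge 0}$ be a $C_0$ contraction semigroup on $H$ with generator $A$, and let $T=(A+I)(A-I)^{-1}$ be its cogenerator. Let $$h_u=\{x\in H:\ \|T_tx\|=\|T_t^*x\|=\|x\|\ \text{for all } t\ge 0\}$$ be the unitary subspace. It is closed and reduces all $T_t$ and $T$, which act on it unitarily. Let $\mathcal U=\{U_t\}_{t\in\mathbb R}$ be the unitary group on $h_u$ with $U_t=T_t|_{h_u}$ for $t\ge 0$, and let $\mathcal C=\{(T|_{h_u})^n\}_{n\in\mathbb Z}$. For $\mathcal S=\mathcal U$ or $\mathcal S=\mathcal C$, with members $S_t$ ($t\in\mathbb R$, respectively $t\in\mathbb Z$), define: - $\Omega_{\mathcal S}$, the set of limit operators, i.e. of all $V\in L(h_u)$ that are limits in the weak operator topology of $S_{t_k}$ for some sequence $t_k\uparrow+\infty$. Alternatively, sequences may be replaced here by nets $t_\alpha\to+\infty$. The two definitions agree if $h_u$ is separable, and the theorem holds for either one (the same one being used for both $\mathcal U$ and $\mathcal C$); - $M(x,\mathcal S)=\overline{\operatorname{span}}\{Vx: V\in\Omega_{\mathcal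 S}\}$ for $x\in h_u$; - $h_m(\mathcal S)=\{x\in h_u:\ x\in M(x,\mathcal S)\}$, the set of weakly Poisson recurrent vectors; - $\mathcal M^{\Omega_{\mathcal S}}$, the limit algebra, i.e. the least subalgebra of $L(h_u)$ that contains $\Omega_{\mathcal S}$, is closed under adjoints and is closed in the weak operator topology (it need not contain the identity operator). **Theorem.** For each of $\mathcal S=\mathcal U,\mathcal C$, the set $h_m(\mathcal S)$ is a closed subspace, and the orthogonal projection $P_{m}(\mathcal S)$ of $h_u$ onto it is the unit of $\mathcal M^{\Omega_{\mathcal S}}$. Moreover, the following are equivalent: (a) $\mathcal U$ and $\mathcal C$ are entangled: $\Omega_{\mathcal U}\cdot x\subset M(x,\mathcal C)$ and $\Omega_{\mathcal C}\cdot x\subset M(x,\mathcal U)$ for all $x\in h_u$; (b) $\mathcal U$ and $\mathcal C$ have a common limit algebra $\mathcal M^{\Omega_{\mathcal U}}=\mathcal M^{\Omega_{\mathcal C}}$, with unit $P_m=P_m(\mathcal U)$; (c) $h_m(\mathcal C)=h_m(\mathcal U)$. -/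

import Mathlib

open Filter Topology MeasureTheory
open scoped NNReal

/-- A strongly continuous (`C₀`) semigroup of contractions on `H`, indexed by `t ≥ 0`. -/
structure ContractionSemigroup (H : Type*) [NormedAddCommGroup H] [InnerProductSpace ℂ H] where
  op : ℝ≥0 → H →L[ℂ] H
  op_zero : op 0 = 1
  op_add : ∀ s t, op (s + t) = op s * op t
  norm_le : ∀ t, ‖op t‖ ≤ 1
  continuous_orbit : ∀ x, Continuous fun t => op t x

namespace ContractionSemigroup

variable {H : Type*} [NormedAddCommGroup H] [InnerProductSpace ℂ H]

theorem norm_op_apply_le (T : ContractionSemigroup H) (t : ℝ≥0) (x : H) : ‖T.op t x‖ ≤ ‖x‖ := by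
  simpa using (T.op t).le_of_opNorm_le (T.norm_le t) x

theorem op_add_apply (T : ContractionSemigroup H) (s t : ℝ≥0) (x : H) :
    T.op (s + t) x = T.op s (T.op t x) := by
  rw [T.op_add]; rfl

/-- `x` lies in the domain of the infinitesimal generator `A` and `A x = y`. -/
def GenMapsTo (T : ContractionSemigroup H) (x y : H) : Prop :=
  Tendsto (fun h : ℝ => h⁻¹ • (T.op h.toNNReal x - x)) (𝓝[>] 0) (𝓝 y)

/-- `D` is the cogenerator `(A + I) (A - I)⁻¹`: the graph of `D` is
`{(A x - x, A x + x) | x ∈ dom A}`. -/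
def IsCogenerator (T : ContractionSemigroup H) (D : H →L[ℂ] H) : Prop :=
  ∀ z w, D z = w ↔ ∃ x y, T.GenMapsTo x y ∧ z = y - x ∧ w = y + x

theorem GenMapsTo.sub {T : ContractionSemigroup H} {x y x' y' : H} (h : T.GenMapsTo x y)
    (h' : T.GenMapsTo x' y') : T.GenMapsTo (x - x') (y - y') := by
  have := Tendsto.sub h h'
  refine this.congr fun t => ?_
  rw [← smul_sub, map_sub]
  congr 1
  abel

theorem GenMapsTo.eq_zero {T : ContractionSemigroup H} {x : H} (h : T.GenMapsTo x x) : x = 0 := by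
  have h1 : Tendsto (fun t : ℝ => (inner ℂ x (t⁻¹ • (T.op t.toNNReal x - x))).re) (𝓝[>] 0)
      (𝓝 (inner ℂ x x).re) :=
    (Complex.continuous_re.tendsto _).comp (tendsto_const_nhds.inner h)
  have h2 : (inner ℂ x x).re ≤ 0 := by
    refine le_of_tendsto h1 ?_
    filter_upwards [self_mem_nhdsWithin] with t ht
    have ht' : (0 : ℝ) < t := ht
    rw [← Complex.coe_smul, inner_smul_right, Complex.re_ofReal_mul]
    refine mul_nonpos_of_nonneg_of_nonpos (by positivity) ?_
    rw [inner_sub_right, Complex.sub_re]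
    have h3 : (inner ℂ x (T.op t.toNNReal x)).re ≤ ‖x‖ * ‖x‖ :=
      (Complex.re_le_norm _).trans ((norm_inner_le_norm _ _).trans
        (mul_le_mul_of_nonneg_left (T.norm_op_apply_le _ _) (norm_nonneg _)))
    have h4 : (inner ℂ x x).re = ‖x‖ * ‖x‖ := by
      have := inner_self_eq_norm_mul_norm (𝕜 := ℂ) x
      simpa using this
    linarith
  have h4 : (inner ℂ x x).re = ‖x‖ * ‖x‖ := by
    have := inner_self_eq_norm_mul_norm (𝕜 := ℂ) x
    simpa using this
  have : ‖x‖ = 0 := by nlinarith [norm_nonneg x]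
  simpa using this

theorem integrableOn_laplace (T : ContractionSemigroup H) (x : H) (a : ℝ) :
    IntegrableOn (fun t : ℝ => Real.exp (-t) • T.op t.toNNReal x) (Set.Ioi a) := by
  have hc : Continuous fun t : ℝ => Real.exp (-t) • T.op t.toNNReal x :=
    (by fun_prop : Continuous fun t : ℝ => Real.exp (-t)).smul
      ((T.continuous_orbit x).comp continuous_real_toNNReal)
  have hi : IntegrableOn (fun t : ℝ => Real.exp (-t) * ‖x‖) (Set.Ioi a) :=
    (integrableOn_exp_neg_Ioi a).mul_const _
  refine Integrable.mono' hi hc.aestronglyMeasurable.restrict (ae_of_all _ fun t => ?_)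
  rw [norm_smul, Real.norm_of_nonneg (Real.exp_pos _).le]
  exact mul_le_mul_of_nonneg_left (T.norm_op_apply_le _ _) (Real.exp_pos _).le

/-- The resolvent of the generator at `1`, as a Laplace transform. -/
noncomputable def laplace (T : ContractionSemigroup H) : H →L[ℂ] H :=
  LinearMap.mkContinuous
    { toFun := fun x => ∫ t in Set.Ioi (0 : ℝ), Real.exp (-t) • T.op t.toNNReal x
      map_add' := fun x y => by
        rw [← integral_add (T.integrableOn_laplace x 0) (T.integrableOn_laplace y 0)]
        simp only [map_add, smul_add]
      map_smul' := fun c x => by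
        rw [RingHom.id_apply, ← integral_smul]
        simp only [map_smul, smul_comm c] } 1 (fun x => by
      have hi : IntegrableOn (fun t : ℝ => Real.exp (-t) * ‖x‖) (Set.Ioi 0) :=
        (integrableOn_exp_neg_Ioi 0).mul_const _
      refine (norm_integral_le_of_norm_le hi (ae_of_all _ fun t => ?_)).trans ?_
      · rw [norm_smul, Real.norm_of_nonneg (Real.exp_pos _).le]
        exact mul_le_mul_of_nonneg_left (T.norm_op_apply_le _ _) (Real.exp_pos _).le
      · rw [integral_mul_const, integral_exp_neg_Ioi_zero])

theorem laplace_apply (T : ContractionSemigroup H) (x : H) :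
    T.laplace x = ∫ t in Set.Ioi (0 : ℝ), Real.exp (-t) • T.op t.toNNReal x := rfl

theorem genMapsTo_laplace [CompleteSpace H] (T : ContractionSemigroup H) (x : H) :
    T.GenMapsTo (T.laplace x) (T.laplace x - x) := by
  set g : ℝ → H := fun t => Real.exp (-t) • T.op t.toNNReal x with hg
  have hc : Continuous g :=
    (by fun_prop : Continuous fun t : ℝ => Real.exp (-t)).smul
      ((T.continuous_orbit x).comp continuous_real_toNNReal)
  have hg0 : g 0 = x := by simp [hg, T.op_zero]
  have key : ∀ h : ℝ, 0 ≤ h →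
      T.op h.toNNReal (T.laplace x) = Real.exp h • (T.laplace x - ∫ t in (0 : ℝ)..h, g t) := by
    intro h hh
    have e1 : T.laplace x - ∫ t in (0 : ℝ)..h, g t = ∫ t in Set.Ioi h, g t := by
      rw [sub_eq_iff_eq_add, laplace_apply, add_comm,
        intervalIntegral.integral_interval_add_Ioi (T.integrableOn_laplace x 0)
          (T.integrableOn_laplace x h)]
    have e2 : ∫ t in Set.Ioi h, g t = ∫ t in Set.Ioi (0 : ℝ), g (t + h) := by
      have := (measurePreserving_add_right volume h).setIntegral_preimage_emb
        (measurableEmbedding_addRight h) g (Set.Ioi h)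
      rw [← this]
      simp
    rw [e1, e2, laplace_apply, ← ContinuousLinearMap.integral_comp_comm _
      (T.integrableOn_laplace x 0), ← integral_smul]
    refine setIntegral_congr_fun measurableSet_Ioi fun t ht => ?_
    have ht' : (0 : ℝ) ≤ t := le_of_lt ht
    simp only [hg]
    rw [smul_smul, ← Real.exp_add, Real.toNNReal_add ht' hh, add_comm t.toNNReal,
      T.op_add_apply, ← Complex.coe_smul, map_smul, Complex.coe_smul]
    congr 2
    ring
  have hd : HasDerivAt (fun h : ℝ => Real.exp h • (T.laplace x - ∫ t in (0 : ℝ)..h, g t))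
      (T.laplace x - x) 0 := by
    have h1 : HasDerivAt (fun h : ℝ => T.laplace x - ∫ t in (0 : ℝ)..h, g t) (-g 0) 0 :=
      (intervalIntegral.integral_hasDerivAt_right (hc.intervalIntegrable _ _)
        hc.stronglyMeasurable.stronglyMeasurableAtFilter hc.continuousAt).const_sub _
    have := (Real.hasDerivAt_exp 0).smul h1
    exact this.congr_deriv (by simp [hg0, sub_eq_add_neg, add_comm])
  have h2 := (hasDerivAt_iff_tendsto_slope_zero.1 hd).mono_left
    (nhdsWithin_mono 0 (fun t (ht : (0 : ℝ) < t) => ht.ne'))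
  refine h2.congr' ?_
  filter_upwards [self_mem_nhdsWithin] with t ht
  rw [key t (le_of_lt ht)]
  simp

theorem isCogenerator_laplace [CompleteSpace H] (T : ContractionSemigroup H) :
    T.IsCogenerator (1 - (2 : ℂ) • T.laplace) := by
  intro z w
  have h := T.genMapsTo_laplace z
  have hD : (1 - (2 : ℂ) • T.laplace) z = z - (2 : ℂ) • T.laplace z := rfl
  constructor
  · rintro rfl
    refine ⟨-T.laplace z, -(T.laplace z - z), ?_, by abel, ?_⟩
    · have h0 : T.GenMapsTo 0 0 := by simp [GenMapsTo]
      simpa using h0.sub h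
    · rw [hD, two_smul]; abel
  · rintro ⟨x, y, hxy, rfl, rfl⟩
    have h0 : T.GenMapsTo 0 0 := by simp [GenMapsTo]
    have h1 := hxy.sub (h0.sub h)
    have h2 : x - (0 - T.laplace (y - x)) = 0 := by
      apply GenMapsTo.eq_zero (T := T)
      convert h1 using 1
      abel
    have h3 : T.laplace (y - x) = -x := by
      rw [zero_sub, sub_neg_eq_add] at h2
      exact (neg_eq_of_add_eq_zero_right h2).symm
    rw [hD, h3, two_smul]; abel

theorem IsCogenerator.unique {T : ContractionSemigroup H} {D D' : H →L[ℂ] H}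
    (h : T.IsCogenerator D) (h' : T.IsCogenerator D') : D = D' := by
  ext z
  exact ((h' z _).2 ((h z _).1 rfl)).symm

/-- The cogenerator of a contraction semigroup: the unique bounded operator whose graph is that
of `(A + I) (A - I)⁻¹`. -/
noncomputable def cogenerator [CompleteSpace H] (T : ContractionSemigroup H) : H →L[ℂ] H :=
  Classical.choose (⟨_, T.isCogenerator_laplace⟩ : ∃ D, T.IsCogenerator D)

theorem isCogenerator_cogenerator [CompleteSpace H] (T : ContractionSemigroup H) :
    T.IsCogenerator T.cogenerator :=
  Classical.choose_spec (⟨_, T.isCogenerator_laplace⟩ : ∃ D, T.IsCogenerator D)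

theorem cogenerator_apply [CompleteSpace H] (T : ContractionSemigroup H) (x : H) :
    T.cogenerator x = x - (2 : ℂ) • T.laplace x := by
  rw [T.isCogenerator_cogenerator.unique T.isCogenerator_laplace]; rfl

/-- A contraction preserves the norm of `x` iff `S* S x = x`. -/
theorem norm_eq_iff_adjoint [CompleteSpace H] {S : H →L[ℂ] H} (hS : ‖S‖ ≤ 1) (x : H) :
    ‖S x‖ = ‖x‖ ↔ S.adjoint (S x) = x := by
  have hS' : ‖S.adjoint‖ ≤ 1 := by simpa using hS
  have h0 : (inner ℂ (S.adjoint (S x)) x) = ((‖S x‖ ^ 2 : ℝ) : ℂ) := by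
    rw [ContinuousLinearMap.adjoint_inner_left, inner_self_eq_norm_sq_to_K]; simp
  constructor
  · intro h
    have h1 : ‖S.adjoint (S x)‖ ≤ ‖S x‖ := by
      simpa using S.adjoint.le_of_opNorm_le hS' (S x)
    have h2 := norm_sub_sq (𝕜 := ℂ) (S.adjoint (S x)) x
    rw [h0] at h2
    simp only [RCLike.re_to_complex, Complex.ofReal_re] at h2
    have h3 : ‖S.adjoint (S x) - x‖ ^ 2 ≤ 0 := by
      rw [h] at h1 h2
      nlinarith [norm_nonneg (S.adjoint (S x)), norm_nonneg x]
    have h4 : ‖S.adjoint (S x) - x‖ = 0 := by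
      nlinarith [norm_nonneg (S.adjoint (S x) - x)]
    exact sub_eq_zero.1 (norm_eq_zero.1 h4)
  · intro h
    rw [h, inner_self_eq_norm_sq_to_K] at h0
    have h5 : ‖x‖ ^ 2 = ‖S x‖ ^ 2 := Complex.ofReal_injective (by simpa using h0)
    exact ((sq_eq_sq₀ (norm_nonneg _) (norm_nonneg _)).1 h5).symm

theorem norm_adjoint_op_le [CompleteSpace H] (T : ContractionSemigroup H) (t : ℝ≥0) :
    ‖(T.op t).adjoint‖ ≤ 1 := by simpa using T.norm_le t

theorem norm_and_norm_iff [CompleteSpace H] (T : ContractionSemigroup H) (t : ℝ≥0) (x : H) :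
    (‖T.op t x‖ = ‖x‖ ∧ ‖(T.op t).adjoint x‖ = ‖x‖) ↔
      ((T.op t).adjoint (T.op t x) = x ∧ T.op t ((T.op t).adjoint x) = x) := by
  have h := norm_eq_iff_adjoint (T.norm_adjoint_op_le t) x
  rw [ContinuousLinearMap.adjoint_adjoint] at h
  rw [norm_eq_iff_adjoint (T.norm_le t), h]

/-- The unitary subspace of `T`: the vectors whose norm is preserved by all `T_t` and `T_t*`. -/
noncomputable def unitarySubspace [CompleteSpace H] (T : ContractionSemigroup H) :
    Submodule ℂ H where
  carrier := {x | ∀ t, ‖T.op t x‖ = ‖x‖ ∧ ‖(T.op t).adjoint x‖ = ‖x‖}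
  zero_mem' := fun t => by simp
  add_mem' := fun {x y} hx hy t => by
    have hx' := (T.norm_and_norm_iff t x).1 (hx t)
    have hy' := (T.norm_and_norm_iff t y).1 (hy t)
    exact (T.norm_and_norm_iff t _).2 (by simp [hx', hy'])
  smul_mem' := fun c x hx t => by simp [norm_smul, (hx t).1, (hx t).2]

theorem mem_unitarySubspace [CompleteSpace H] (T : ContractionSemigroup H) {x : H} :
    x ∈ T.unitarySubspace ↔ ∀ t, ‖T.op t x‖ = ‖x‖ ∧ ‖(T.op t).adjoint x‖ = ‖x‖ := Iff.rfl

theorem isClosed_unitarySubspace [CompleteSpace H] (T : ContractionSemigroup H) :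
    IsClosed (T.unitarySubspace : Set H) := by
  have : (T.unitarySubspace : Set H) =
      ⋂ t, {x | ‖T.op t x‖ = ‖x‖ ∧ ‖(T.op t).adjoint x‖ = ‖x‖} := by
    ext x; simp [mem_unitarySubspace]
  rw [this]
  refine isClosed_iInter fun t => IsClosed.inter ?_ ?_
  · exact isClosed_eq (by fun_prop) (by fun_prop)
  · exact isClosed_eq (by fun_prop) (by fun_prop)

instance [CompleteSpace H] (T : ContractionSemigroup H) : CompleteSpace T.unitarySubspace :=
  T.isClosed_unitarySubspace.completeSpace_coe

theorem op_mem_unitarySubspace [CompleteSpace H] (T : ContractionSemigroup H) (s : ℝ≥0) {x : H}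
    (hx : x ∈ T.unitarySubspace) : T.op s x ∈ T.unitarySubspace := by
  intro t
  constructor
  · rw [← T.op_add_apply, (hx _).1, (hx _).1]
  · have key : ∀ r, (T.op r).adjoint (T.op r x) = x := fun r =>
      ((T.norm_and_norm_iff r x).1 (hx r)).1
    rw [(hx s).1]
    rcases le_total t s with h | h
    · obtain ⟨r, rfl⟩ := exists_add_of_le h
      rw [T.op_add_apply]
      have : ‖T.op t (T.op r x)‖ = ‖T.op r x‖ := by
        rw [← T.op_add_apply, (hx _).1, (hx _).1]
      rw [(norm_eq_iff_adjoint (T.norm_le t) _).1 this, (hx r).1]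
    · obtain ⟨r, rfl⟩ := exists_add_of_le h
      have : (T.op (s + r)).adjoint (T.op s x) = (T.op r).adjoint x := by
        have e : (T.op (s + r)).adjoint = (T.op r).adjoint ∘L (T.op s).adjoint := by
          rw [T.op_add]; exact ContinuousLinearMap.adjoint_comp _ _
        rw [e, ContinuousLinearMap.comp_apply, key s]
      rw [this, (hx r).2]

theorem cogenerator_mem_unitarySubspace [CompleteSpace H] (T : ContractionSemigroup H) {x : H}
    (hx : x ∈ T.unitarySubspace) : T.cogenerator x ∈ T.unitarySubspace := by
  rw [cogenerator_apply]
  refine Submodule.sub_mem _ hx (Submodule.smul_mem _ _ ?_)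
  set L : H →L[ℂ] T.unitarySubspaceᗮ := T.unitarySubspaceᗮ.orthogonalProjectionOnto
  have hL : ∀ y, y ∈ T.unitarySubspace → L y = 0 := fun y hy =>
    Submodule.orthogonalProjectionOnto_apply_of_mem_orthogonal
      (by rwa [T.unitarySubspace.orthogonal_orthogonal])
  have h1 : L (T.laplace x) = 0 := by
    rw [laplace_apply, ← ContinuousLinearMap.integral_comp_comm _ (T.integrableOn_laplace x 0)]
    refine integral_eq_zero_of_ae (ae_of_all _ fun t => hL _ ?_)
    rw [← Complex.coe_smul]
    exact Submodule.smul_mem _ _ (T.op_mem_unitarySubspace _ hx)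
  have h2 := Submodule.orthogonalProjectionOnto_eq_zero_iff.1 h1
  rwa [T.unitarySubspace.orthogonal_orthogonal] at h2

/-- The restriction of `T_t` to the unitary subspace. -/
noncomputable def unitaryPart [CompleteSpace H] (T : ContractionSemigroup H) (t : ℝ≥0) :
    T.unitarySubspace →L[ℂ] T.unitarySubspace :=
  (T.op t).restrict fun _ hx => T.op_mem_unitarySubspace t hx

/-- The restriction of the cogenerator of `T` to the unitary subspace. -/
noncomputable def cogeneratorUnitaryPart [CompleteSpace H] (T : ContractionSemigroup H) :
    T.unitarySubspace →L[ℂ] T.unitarySubspace :=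
  T.cogenerator.restrict fun _ hx => T.cogenerator_mem_unitarySubspace hx

/-- The unitary group `(U_t)`, `t ∈ ℝ`, defined by `T` on its unitary subspace. -/
noncomputable def unitaryGroup [CompleteSpace H] (T : ContractionSemigroup H) (t : ℝ) :
    T.unitarySubspace →L[ℂ] T.unitarySubspace :=
  if 0 ≤ t then T.unitaryPart t.toNNReal else (T.unitaryPart (-t).toNNReal).adjoint

/-- The discrete unitary group `(Uⁿ)`, `n ∈ ℤ`, defined by the cogenerator of `T` on the
unitary subspace (the adjoint being the inverse there). -/
noncomputable def cogeneratorGroup [CompleteSpace H] (T : ContractionSemigroup H) (n : ℤ) :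
    T.unitarySubspace →L[ℂ] T.unitarySubspace :=
  if 0 ≤ n then T.cogeneratorUnitaryPart ^ n.toNat
  else T.cogeneratorUnitaryPart.adjoint ^ (-n).toNat

end ContractionSemigroup

/-- The two usual ways to read "weak operator limit as `t → +∞`". They agree when the space is
separable. -/
inductive LimitKind
  | sequences
  | nets

section LimitOperators

variable {K : Type*} [NormedAddCommGroup K] [InnerProductSpace ℂ K] {ι κ : Type*} [Preorder ι]
  [Preorder κ]

/-- The set `Ω` of limit operators of a family `S`: the limits, in the weak operator topology, of
`S (t k)` for sequences (or nets) `t k` increasing (tending) to `+∞`. The limits along nets are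
the cluster points of `S` at `+∞`. -/
def limitOperators (S : ι → K →L[ℂ] K) : LimitKind → Set (K →L[ℂ] K)
  | .sequences => {V | ∃ t : ℕ → ι, Monotone t ∧ Tendsto t atTop atTop ∧
      Tendsto (fun k => ContinuousLinearMapWOT.ofCLM (S (t k))) atTop
        (𝓝 (ContinuousLinearMapWOT.ofCLM V))}
  | .nets => {V | MapClusterPt (ContinuousLinearMapWOT.ofCLM V) atTop
      fun t => ContinuousLinearMapWOT.ofCLM (S t)}

/-- The limit subspace `M(x, S)`: the closed linear span of `Ω · x`. -/
def limitSubspace (S : ι → K →L[ℂ] K) (m : LimitKind) (x : K) : Submodule ℂ K :=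
  (Submodule.span ℂ ((fun V : K →L[ℂ] K => V x) '' limitOperators S m)).topologicalClosure

/-- The weakly Poisson recurrent vectors `h_m(S)`: those `x` with `x ∈ M(x, S)`. -/
def weaklyPoissonRecurrent (S : ι → K →L[ℂ] K) (m : LimitKind) : Set K :=
  {x | x ∈ limitSubspace S m x}

/-- `S` and `R` are entangled: `Ω_S · x ⊆ M(x, R)` and `Ω_R · x ⊆ M(x, S)` for all `x`. -/
def Entangled (S : ι → K →L[ℂ] K) (R : κ → K →L[ℂ] K) (m : LimitKind) : Prop :=
  ∀ x, (∀ V ∈ limitOperators S m, V x ∈ limitSubspace R m x) ∧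
    (∀ V ∈ limitOperators R m, V x ∈ limitSubspace S m x)

/-- The limit algebra: the least subalgebra of `L(K)` that is closed under adjoints, closed in the
weak operator topology, and contains the limit operators (it need not contain the identity). -/
noncomputable def limitAlgebra [CompleteSpace K] (S : ι → K →L[ℂ] K) (m : LimitKind) :
    NonUnitalStarSubalgebra ℂ (K →L[ℂ] K) :=
  sInf {A | limitOperators S m ⊆ A ∧
    IsClosed {B : K →WOT[ℂ] K | B.toCLM ∈ A}}

/-- `P` is the unit of the algebra `A`. -/
def IsUnitOf [CompleteSpace K] (P : K →L[ℂ] K) (A : NonUnitalStarSubalgebra ℂ (K →L[ℂ] K)) :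
    Prop :=
  P ∈ A ∧ ∀ B ∈ A, P * B = B ∧ B * P = B

/-- `P` is the orthogonal projection onto the set `M` (which is then a closed subspace). -/
def IsOrthogonalProjectionOnto [CompleteSpace K] (P : K →L[ℂ] K) (M : Set K) : Prop :=
  IsStarProjection P ∧ Set.range P = M

end LimitOperators

/-! Let `X` be the range of a unitary group and `Ω` its limit operators. Then `X` is commutative and
self-adjoint, `Ω` lies in the bicommutant of `X`, and `X * Ω ⊆ Ω`. Only these facts are used, so
sequences and nets are treated alike.

The closed span of `Ω x` is `X`-invariant, so its projection `E` lies in the commutant of `X`. Every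
`V ∈ Ω` therefore commutes with `E`, and `V (x - E x) = V x - E (V x) = 0`. The residual `x - E x`
is thus in the common kernel of `Ω`. With `P` the projection onto the complement of this kernel, it
follows that the recurrent vectors form the range of `P` (`mem_closedOrbitSpan_self_iff`). The same
argument on finite sums of copies of the space, as in von Neumann's density theorem, shows that the
limit algebra is the corner of the bicommutant cut out by `P` (`mem_weakAlgebra_iff`).

The cogenerator is `1 - 2L`, where `L` is the resolvent at `1`, and it has the same commutant as the
semigroup (`commute_cogenerator_iff`). Both limit algebras are therefore corners of one bicommutant:
they agree once their recurrent subspaces do. A common algebra gives entanglement, since each of its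
operators maps `x` into both limit subspaces; entanglement makes these subspaces include one
another's recurrent vectors. -/

/-! ### Weakly closed sets of operators -/

section WeakOperatorClosure

variable {K : Type*} [NormedAddCommGroup K] [InnerProductSpace ℂ K]

/-- Every limit operator lies in each weakly closed set that contains the family. -/
theorem limitOperators_subset_of_isClosed {ι : Type*} [Preorder ι] {S : ι → K →L[ℂ] K}
    {Z : Set (K →WOT[ℂ] K)} (hZ : IsClosed Z)
    (hS : ∀ t, ContinuousLinearMapWOT.ofCLM (S t) ∈ Z) (m : LimitKind) {V : K →L[ℂ] K}
    (hV : V ∈ limitOperators S m) : ContinuousLinearMapWOT.ofCLM V ∈ Z := by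
  cases m with
  | sequences =>
    obtain ⟨t, -, -, ht⟩ := hV
    exact hZ.mem_of_tendsto ht (Eventually.of_forall fun k => hS _)
  | nets =>
    have hV : MapClusterPt (ContinuousLinearMapWOT.ofCLM V) atTop
      fun t => ContinuousLinearMapWOT.ofCLM (S t) := hV
    exact hZ.mem_of_mapClusterPt hV (Eventually.of_forall hS)

/-- Multiplication is separately continuous in the weak operator topology, so commuting with one
fixed operator is a closed condition. -/
theorem isClosed_setOf_toCLM_mem_centralizer (X : Set (K →L[ℂ] K)) :
    IsClosed {B : K →WOT[ℂ] K | B.toCLM ∈ X.centralizer} := by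
  have : {B : K →WOT[ℂ] K | B.toCLM ∈ X.centralizer} =
      ⋂ Y ∈ X, {B | ContinuousLinearMapWOT.ofCLM Y * B = B * ContinuousLinearMapWOT.ofCLM Y} := by
    ext B
    simp only [Set.mem_ofPred_eq, Set.mem_centralizer_iff, Set.mem_iInter]
    exact forall₂_congr fun Y _ => (ContinuousLinearMapWOT.ofCLM_injective (σ := RingHom.id ℂ)).eq_iff.symm
  rw [this]
  exact isClosed_biInter fun Y _ =>
    isClosed_eq (continuous_const_mul _) (continuous_mul_const _)

/-- A weakly closed set contains every operator that it approximates on finite sets of vectors. -/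
theorem toCLM_mem_of_forall_finset [CompleteSpace K] {A : Set (K →L[ℂ] K)}
    (hA : IsClosed {B : K →WOT[ℂ] K | B.toCLM ∈ A}) {B : K →L[ℂ] K}
    (h : ∀ (F : Finset K) (ε : ℝ), 0 < ε → ∃ B' ∈ A, ∀ x ∈ F, ‖B' x - B x‖ < ε) : B ∈ A := by
  classical
  -- The approximants form a net indexed by a finite set of vectors and a tolerance `1 / (n + 1)`;
  -- it converges strongly, hence weakly.
  choose f hfA hf using fun p : Finset K × ℕ => h p.1 (1 / ((p.2 : ℝ) + 1)) (by positivity)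
  have ht : Tendsto (fun p => ContinuousLinearMapWOT.ofCLM (f p)) atTop
      (𝓝 (ContinuousLinearMapWOT.ofCLM B : K →WOT[ℂ] K)) := by
    rw [ContinuousLinearMapWOT.tendsto_iff_forall_dual_apply_tendsto]
    intro x y
    refine (y.continuous.tendsto (B x)).comp ?_
    rw [tendsto_iff_norm_sub_tendsto_zero]
    have h1 : Tendsto (fun p : Finset K × ℕ => 1 / ((p.2 : ℝ) + 1)) atTop (𝓝 0) := by
      rw [← prod_atTop_atTop_eq]
      exact tendsto_one_div_add_atTop_nhds_zero_nat.comp tendsto_snd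
    refine squeeze_zero' (Eventually.of_forall fun _ => norm_nonneg _) ?_ h1
    filter_upwards [eventually_ge_atTop (({x} : Finset K), 0)] with p hp
    exact (hf p x (hp.1 (Finset.mem_singleton_self x))).le
  exact hA.mem_of_tendsto ht (Eventually.of_forall fun p => hfA p)

end WeakOperatorClosure

/-! ### Finite amplifications -/

section Amplification

variable {K : Type*} [NormedAddCommGroup K] [InnerProductSpace ℂ K] {ι : Type*} [Fintype ι]

/-- The operator on the Hilbert sum of copies of `K` that acts by `B` on every copy. -/
noncomputable def amplify (ι : Type*) [Fintype ι] (B : K →L[ℂ] K) :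
    PiLp 2 (fun _ : ι => K) →L[ℂ] PiLp 2 (fun _ : ι => K) :=
  (PiLp.continuousLinearEquiv 2 ℂ (fun _ : ι => K)).symm.toContinuousLinearMap ∘L
    ContinuousLinearMap.pi fun i => B ∘L PiLp.proj 2 (fun _ : ι => K) i

@[simp]
theorem amplify_apply (B : K →L[ℂ] K) (x : PiLp 2 (fun _ : ι => K)) (i : ι) :
    amplify ι B x i = B (x i) := rfl

theorem star_amplify [CompleteSpace K] (B : K →L[ℂ] K) :
    star (amplify ι B) = amplify ι (star B) := by
  rw [ContinuousLinearMap.star_eq_adjoint, ContinuousLinearMap.star_eq_adjoint, eq_comm,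
    ContinuousLinearMap.eq_adjoint_iff]
  intro x y
  simp [PiLp.inner_apply, ContinuousLinearMap.adjoint_inner_left]

/-- Amplification maps the bicommutant of a set into the bicommutant of the amplified set. -/
theorem amplify_mem_centralizer_centralizer {X : Set (K →L[ℂ] K)} {B : K →L[ℂ] K}
    (hB : B ∈ X.centralizer.centralizer) :
    amplify ι B ∈ (amplify ι '' X).centralizer.centralizer := by
  classical
  intro E hE
  set e := (PiLp.continuousLinearEquiv 2 ℂ (fun _ : ι => K)).symm
  let s : ι → K →L[ℂ] PiLp 2 (fun _ : ι => K) := fun j =>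
    e.toContinuousLinearMap ∘L ContinuousLinearMap.single ℂ (fun _ : ι => K) j
  have hs : ∀ (C : K →L[ℂ] K) j y, amplify ι C (s j y) = s j (C y) := by
    intro C j y
    ext i
    change C (Pi.single (M := fun _ : ι => K) j y i) = Pi.single (M := fun _ : ι => K) j (C y) i
    rcases eq_or_ne i j with rfl | hij
    · simp
    · simp [hij]
  have hsum : ∀ x : PiLp 2 (fun _ : ι => K), x = ∑ j, s j (x j) := by
    intro x
    have h1 := Finset.univ_sum_single (x.ofLp)
    have h2 := congrArg e h1
    rw [map_sum] at h2
    exact h2.symm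
  -- An operator commuting with all diagonal `amplify ι C` has matrix entries commuting with `C`;
  -- `B` then commutes with each entry.
  have hentry : ∀ i j, PiLp.proj 2 (fun _ : ι => K) i ∘L E ∘L s j ∈ X.centralizer := by
    intro i j C hC
    ext y
    have h1 := DFunLike.congr_fun (hE _ ⟨C, hC, rfl⟩) (s j y)
    have h2 := congrArg (fun v : PiLp 2 (fun _ : ι => K) => v i) h1
    simp only [mul_apply_eq_comp, amplify_apply, hs] at h2
    exact h2
  refine ContinuousLinearMap.ext fun x => ?_
  rw [hsum x, map_sum, map_sum]
  refine Finset.sum_congr rfl fun j _ => ?_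
  ext i
  have h1 := DFunLike.congr_fun (hB _ (hentry i j)) (x j)
  simp only [mul_apply_eq_comp, hs, amplify_apply]
  exact h1

end Amplification

/-! ### Cyclic subspaces and their projections -/

section Cyclic

variable {K : Type*} [NormedAddCommGroup K] [InnerProductSpace ℂ K]

/-- The projection onto a closed subspace that is invariant under a self-adjoint set of operators
commutes with that set. -/
theorem starProjection_mem_centralizer [CompleteSpace K] {X : Set (K →L[ℂ] K)} (hX : ∀ s ∈ X, star s ∈ X)
    (W : Submodule ℂ K) [W.HasOrthogonalProjection] (hW : ∀ s ∈ X, ∀ w ∈ W, s w ∈ W) :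
    W.starProjection ∈ X.centralizer := by
  have h1 : ∀ s ∈ X, W.starProjection * (s * W.starProjection) = s * W.starProjection := by
    intro s hs
    ext x
    exact W.starProjection_eq_self_iff.2 (hW s hs _ (W.starProjection_apply_mem x))
  have hE : star W.starProjection = W.starProjection :=
    (isStarProjection_starProjection (U := W)).isSelfAdjoint
  intro s hs
  -- The adjoint of the invariance under `star s` reads `E s E = E s`; together with `E s E = s E`
  -- this gives commutation.
  have h2 := congrArg star (h1 (star s) (hX s hs))
  simp only [star_mul, star_star, hE] at h2
  rw [← h1 s hs, ← mul_assoc, h2]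

/-- The closed linear span of the orbit of `x` under a set of operators. -/
def closedOrbitSpan (Ω : Set (K →L[ℂ] K)) (x : K) : Submodule ℂ K :=
  (Submodule.span ℂ ((fun V : K →L[ℂ] K => V x) '' Ω)).topologicalClosure

instance [CompleteSpace K] (Ω : Set (K →L[ℂ] K)) (x : K) : CompleteSpace (closedOrbitSpan Ω x) :=
  (Submodule.isClosed_topologicalClosure _).completeSpace_coe

theorem apply_mem_closedOrbitSpan {Ω : Set (K →L[ℂ] K)} {V : K →L[ℂ] K} (hV : V ∈ Ω) (x : K) :
    V x ∈ closedOrbitSpan Ω x :=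
  Submodule.le_topologicalClosure _ (Submodule.subset_span ⟨V, hV, rfl⟩)

theorem closedOrbitSpan_le {Ω : Set (K →L[ℂ] K)} {x : K} {W : Submodule ℂ K}
    (hW : IsClosed (W : Set K)) (h : ∀ V ∈ Ω, V x ∈ W) : closedOrbitSpan Ω x ≤ W :=
  Submodule.topologicalClosure_minimal _
    (Submodule.span_le.2 (by rintro _ ⟨V, hV, rfl⟩; exact h V hV)) hW

variable [CompleteSpace K] {X Ω : Set (K →L[ℂ] K)}

/-- Since `X * Ω ⊆ Ω`, each `s ∈ X` maps the orbit of `x` into itself, and by continuity its closed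
span too. -/
theorem starProjection_closedOrbitSpan_mem_centralizer (hX : ∀ s ∈ X, star s ∈ X)
    (hΩ : ∀ s ∈ X, ∀ V ∈ Ω, s * V ∈ Ω) (x : K) :
    (closedOrbitSpan Ω x).starProjection ∈ X.centralizer := by
  refine starProjection_mem_centralizer hX _ fun s hs w hw => ?_
  have : closedOrbitSpan Ω x ≤ (closedOrbitSpan Ω x).comap (s : K →ₗ[ℂ] K) :=
    closedOrbitSpan_le ((Submodule.isClosed_topologicalClosure _).preimage s.continuous)
      fun V hV => apply_mem_closedOrbitSpan (hΩ s hs V hV) x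
  exact this hw

/-- The part of `x` orthogonal to its orbit span is killed by every operator of `Ω`. -/
theorem apply_sub_starProjection_closedOrbitSpan (hX : ∀ s ∈ X, star s ∈ X)
    (hΩ : ∀ s ∈ X, ∀ V ∈ Ω, s * V ∈ Ω) (hΩX : Ω ⊆ X.centralizer.centralizer) (x : K)
    {V : K →L[ℂ] K} (hV : V ∈ Ω) :
    V (x - (closedOrbitSpan Ω x).starProjection x) = 0 := by
  have h1 := DFunLike.congr_fun
    (hΩX hV _ (starProjection_closedOrbitSpan_mem_centralizer hX hΩ x)) x
  have h2 := (Submodule.starProjection_eq_self_iff (K := closedOrbitSpan Ω x)).2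
    (apply_mem_closedOrbitSpan hV x)
  simp only [mul_apply_eq_comp] at h1
  rw [map_sub, ← h1, h2, sub_self]

end Cyclic

/-! ### The weakly closed algebra generated by `Ω` -/

section LimitAlgebra

variable {K : Type*} [NormedAddCommGroup K] [InnerProductSpace ℂ K]

/-- The orthogonal complement of the vectors killed by all operators of `Ω`. -/
noncomputable def supportSubspace (Ω : Set (K →L[ℂ] K)) : Submodule ℂ K :=
  (⨅ V ∈ Ω, LinearMap.ker (V : K →ₗ[ℂ] K))ᗮ

instance [CompleteSpace K] (Ω : Set (K →L[ℂ] K)) : CompleteSpace (supportSubspace Ω) :=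
  (Submodule.isClosed_orthogonal _).completeSpace_coe

theorem isClosed_iInf_ker (Ω : Set (K →L[ℂ] K)) :
    IsClosed ((⨅ V ∈ Ω, LinearMap.ker (V : K →ₗ[ℂ] K) : Submodule ℂ K) : Set K) := by
  simp only [Submodule.coe_iInf]
  exact isClosed_biInter fun V _ => V.isClosed_ker

variable [CompleteSpace K]

theorem mem_orthogonal_supportSubspace {Ω : Set (K →L[ℂ] K)} {z : K} :
    z ∈ (supportSubspace Ω)ᗮ ↔ ∀ V ∈ Ω, V z = 0 := by
  have := (isClosed_iInf_ker Ω).completeSpace_coe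
  rw [supportSubspace, Submodule.orthogonal_orthogonal]
  simp

variable {X Ω : Set (K →L[ℂ] K)}

theorem comp_starProjection_supportSubspace {V : K →L[ℂ] K} (hV : V ∈ Ω) :
    V * (supportSubspace Ω).starProjection = V := by
  ext x
  have h := mem_orthogonal_supportSubspace.1
    ((supportSubspace Ω).sub_starProjection_mem_orthogonal x) V hV
  rw [map_sub, sub_eq_zero] at h
  exact h.symm

/-- As `X` is commutative, its bicommutant lies in its commutant. Hence `star V` is in the
commutant, and `V` commutes with it. -/
theorem isStarNormal_of_mem (hX : ∀ s ∈ X, star s ∈ X) (hcomm : ∀ s ∈ X, ∀ t ∈ X, s * t = t * s)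
    (hΩX : Ω ⊆ X.centralizer.centralizer) {V : K →L[ℂ] K} (hV : V ∈ Ω) :
    star V * V = V * star V := by
  have h1 : X.centralizer.centralizer ⊆ X.centralizer :=
    Set.centralizer_subset fun s hs t ht => hcomm t ht s hs
  exact hΩX hV _ (Set.star_mem_centralizer' hX (h1 (hΩX hV)))

/-- A normal operator has the same kernel as its adjoint, so its range is orthogonal to its kernel,
hence to the common kernel. -/
theorem apply_mem_supportSubspace (hX : ∀ s ∈ X, star s ∈ X)
    (hcomm : ∀ s ∈ X, ∀ t ∈ X, s * t = t * s) (hΩX : Ω ⊆ X.centralizer.centralizer)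
    {V : K →L[ℂ] K} (hV : V ∈ Ω) (x : K) : V x ∈ supportSubspace Ω := by
  rw [supportSubspace, Submodule.mem_orthogonal]
  intro z hz
  have hz : V z = 0 := by
    simp only [Submodule.mem_iInf] at hz
    exact hz V hV
  have h1 := DFunLike.congr_fun (isStarNormal_of_mem hX hcomm hΩX hV) z
  have h2 : V (star V z) = 0 := by
    simpa [hz] using h1.symm
  have h3 : star V z = 0 := by
    rw [← inner_self_eq_zero (𝕜 := ℂ), ContinuousLinearMap.star_eq_adjoint,
      ContinuousLinearMap.adjoint_inner_left, ← ContinuousLinearMap.star_eq_adjoint, h2,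
      inner_zero_right]
  rw [← ContinuousLinearMap.adjoint_inner_left, ← ContinuousLinearMap.star_eq_adjoint, h3,
    inner_zero_left]

theorem starProjection_supportSubspace_comp (hX : ∀ s ∈ X, star s ∈ X)
    (hcomm : ∀ s ∈ X, ∀ t ∈ X, s * t = t * s) (hΩX : Ω ⊆ X.centralizer.centralizer)
    {V : K →L[ℂ] K} (hV : V ∈ Ω) : (supportSubspace Ω).starProjection * V = V := by
  ext x
  exact Submodule.starProjection_eq_self_iff.2 (apply_mem_supportSubspace hX hcomm hΩX hV x)

/-- For `x` in the support, the part of `x` orthogonal to its orbit span lies both in the support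
and in the common kernel, so it vanishes. -/
theorem mem_closedOrbitSpan_self_iff (hX : ∀ s ∈ X, star s ∈ X)
    (hcomm : ∀ s ∈ X, ∀ t ∈ X, s * t = t * s) (hΩ : ∀ s ∈ X, ∀ V ∈ Ω, s * V ∈ Ω)
    (hΩX : Ω ⊆ X.centralizer.centralizer) (x : K) :
    x ∈ closedOrbitSpan Ω x ↔ x ∈ supportSubspace Ω := by
  have hle : closedOrbitSpan Ω x ≤ supportSubspace Ω :=
    closedOrbitSpan_le (Submodule.isClosed_orthogonal _)
      fun V hV => apply_mem_supportSubspace hX hcomm hΩX hV x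
  refine ⟨fun h => hle h, fun h => ?_⟩
  rw [← Submodule.starProjection_eq_self_iff, eq_comm, ← sub_eq_zero]
  have h1 : x - (closedOrbitSpan Ω x).starProjection x ∈ supportSubspace Ω :=
    Submodule.sub_mem _ h (hle (Submodule.starProjection_apply_mem _ x))
  have h2 : x - (closedOrbitSpan Ω x).starProjection x ∈ (supportSubspace Ω)ᗮ :=
    mem_orthogonal_supportSubspace.2
      fun V hV => apply_sub_starProjection_closedOrbitSpan hX hΩ hΩX x hV
  exact inner_self_eq_zero.1 (h2 _ h1)

/-- An operator of the bicommutant that lives on the support of `Ω` is approximated by linear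
combinations of operators of `Ω` on every finite set of vectors. -/
theorem exists_mem_span_approx (hX : ∀ s ∈ X, star s ∈ X) (hΩ : ∀ s ∈ X, ∀ V ∈ Ω, s * V ∈ Ω)
    (hΩX : Ω ⊆ X.centralizer.centralizer) {B : K →L[ℂ] K} (hB : B ∈ X.centralizer.centralizer)
    (hBP : B * (supportSubspace Ω).starProjection = B) (F : Finset K) {ε : ℝ} (hε : 0 < ε) :
    ∃ B' ∈ Submodule.span ℂ Ω, ∀ x ∈ F, ‖B' x - B x‖ < ε := by
  -- The vector `v` lists the elements of `F`, so approximating `B` on `F` is approximating `amplify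
  -- F B v` in the cyclic space of `v`.
  set v : PiLp 2 (fun _ : F => K) := WithLp.toLp 2 Subtype.val with hv
  set P := (supportSubspace Ω).starProjection
  set X' := amplify F '' X
  set Ω' := amplify F '' Ω
  have hX' : ∀ s ∈ X', star s ∈ X' := by
    rintro _ ⟨s, hs, rfl⟩
    exact ⟨star s, hX s hs, (star_amplify s).symm⟩
  have hΩ' : ∀ s ∈ X', ∀ V ∈ Ω', s * V ∈ Ω' := by
    rintro _ ⟨s, hs, rfl⟩ _ ⟨V, hV, rfl⟩
    exact ⟨s * V, hΩ s hs V hV, rfl⟩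
  have hΩX' : Ω' ⊆ X'.centralizer.centralizer := by
    rintro _ ⟨V, hV, rfl⟩
    exact amplify_mem_centralizer_centralizer (hΩX hV)
  set W := closedOrbitSpan Ω' v
  set E := W.starProjection
  have hEX : E ∈ X'.centralizer := starProjection_closedOrbitSpan_mem_centralizer hX' hΩ' v
  -- Each coordinate of the residual is killed by `Ω`, and `B = B P` vanishes on such vectors.
  have h0 : amplify F B (v - E v) = 0 := by
    ext i
    have h1 : (v - E v) i ∈ (supportSubspace Ω)ᗮ := by
      refine mem_orthogonal_supportSubspace.2 fun V hV => ?_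
      have := apply_sub_starProjection_closedOrbitSpan hX' hΩ' hΩX' v ⟨V, hV, rfl⟩
      exact congrArg (fun w : PiLp 2 (fun _ : F => K) => w i) this
    have h2 : P ((v - E v) i) = 0 := (Submodule.starProjection_apply_eq_zero_iff _).2 h1
    rw [amplify_apply, ← hBP, mul_apply_eq_comp, h2, map_zero]
    rfl
  have hW : amplify F B v ∈ W := by
    have h1 := DFunLike.congr_fun (amplify_mem_centralizer_centralizer hB E hEX) v
    simp only [mul_apply_eq_comp] at h1
    rw [map_sub, sub_eq_zero] at h0
    rw [h0, ← h1]
    exact W.starProjection_apply_mem _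
  obtain ⟨w, hw, hdist⟩ := Metric.mem_closure_iff.1 hW ε hε
  have hspan : ∀ u ∈ Submodule.span ℂ ((fun V => V v) '' Ω'),
      ∃ B' ∈ Submodule.span ℂ Ω, amplify F B' v = u := by
    intro u hu
    induction hu using Submodule.span_induction with
    | mem u hu =>
      obtain ⟨_, ⟨V, hV, rfl⟩, rfl⟩ := hu
      exact ⟨V, Submodule.subset_span hV, rfl⟩
    | zero => exact ⟨0, Submodule.zero_mem _, rfl⟩
    | add u u' _ _ h h' =>
      obtain ⟨C, hC, rfl⟩ := h
      obtain ⟨C', hC', rfl⟩ := h'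
      exact ⟨C + C', Submodule.add_mem _ hC hC', rfl⟩
    | smul c u _ h =>
      obtain ⟨C, hC, rfl⟩ := h
      exact ⟨c • C, Submodule.smul_mem _ c hC, rfl⟩
  obtain ⟨B', hB', rfl⟩ := hspan w hw
  refine ⟨B', hB', fun x hx => ?_⟩
  rw [dist_comm, dist_eq_norm] at hdist
  exact (PiLp.norm_apply_le (amplify F B' v - amplify F B v) ⟨x, hx⟩).trans_lt hdist

/-- The least weakly closed star subalgebra that contains `Ω`. -/
noncomputable def weakAlgebra (Ω : Set (K →L[ℂ] K)) : NonUnitalStarSubalgebra ℂ (K →L[ℂ] K) :=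
  sInf {A | Ω ⊆ A ∧ IsClosed {B : K →WOT[ℂ] K | B.toCLM ∈ A}}

/-- The right-hand side defines a weakly closed star algebra containing `Ω`, which gives one
inclusion. The other is the density statement `exists_mem_span_approx`. -/
theorem mem_weakAlgebra_iff (hX : ∀ s ∈ X, star s ∈ X)
    (hcomm : ∀ s ∈ X, ∀ t ∈ X, s * t = t * s) (hΩ : ∀ s ∈ X, ∀ V ∈ Ω, s * V ∈ Ω)
    (hΩX : Ω ⊆ X.centralizer.centralizer) {B : K →L[ℂ] K} :
    B ∈ weakAlgebra Ω ↔ B ∈ X.centralizer.centralizer ∧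
      (supportSubspace Ω).starProjection * B = B ∧
      B * (supportSubspace Ω).starProjection = B := by
  set P := (supportSubspace Ω).starProjection with hP
  have hPstar : star P = P := (isStarProjection_starProjection (U := supportSubspace Ω)).isSelfAdjoint
  constructor
  · intro hB
    have hX' : ∀ s ∈ X.centralizer, star s ∈ X.centralizer :=
      fun s hs => Set.star_mem_centralizer' hX hs
    let D : NonUnitalStarSubalgebra ℂ (K →L[ℂ] K) :=
      { carrier := {B | B ∈ X.centralizer.centralizer ∧ P * B = B ∧ B * P = B}
        add_mem' := fun {a b} ha hb => ⟨fun Y hY => by rw [mul_add, add_mul, ha.1 Y hY, hb.1 Y hY],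
          by rw [mul_add, ha.2.1, hb.2.1], by rw [add_mul, ha.2.2, hb.2.2]⟩
        zero_mem' := ⟨fun Y _ => by rw [mul_zero, zero_mul], mul_zero _, zero_mul _⟩
        mul_mem' := fun {a b} ha hb => ⟨Set.mul_mem_centralizer ha.1 hb.1,
          by rw [← mul_assoc, ha.2.1], by rw [mul_assoc, hb.2.2]⟩
        smul_mem' := fun c a ha => ⟨fun Y hY => by rw [mul_smul_comm, smul_mul_assoc, ha.1 Y hY],
          by rw [mul_smul_comm, ha.2.1], by rw [smul_mul_assoc, ha.2.2]⟩
        star_mem' := fun {a} ha => ⟨Set.star_mem_centralizer' hX' ha.1,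
          by simpa [hPstar] using congrArg star ha.2.2,
          by simpa [hPstar] using congrArg star ha.2.1⟩ }
    have hD : weakAlgebra Ω ≤ D := by
      refine sInf_le ⟨fun V hV => ⟨hΩX hV, starProjection_supportSubspace_comp hX hcomm hΩX hV,
        comp_starProjection_supportSubspace hV⟩, ?_⟩
      refine (isClosed_setOf_toCLM_mem_centralizer X.centralizer).inter (IsClosed.inter
        (s₁ := {B : K →WOT[ℂ] K | P * B.toCLM = B.toCLM})
        (s₂ := {B : K →WOT[ℂ] K | B.toCLM * P = B.toCLM}) ?_ ?_)
      · have : {B : K →WOT[ℂ] K | P * B.toCLM = B.toCLM} =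
            {B | ContinuousLinearMapWOT.ofCLM P * B = B} := by
          ext B; exact ContinuousLinearMapWOT.ofCLM_injective.eq_iff.symm
        rw [this]
        exact isClosed_eq (continuous_const_mul _) continuous_id
      · have : {B : K →WOT[ℂ] K | B.toCLM * P = B.toCLM} =
            {B | B * ContinuousLinearMapWOT.ofCLM P = B} := by
          ext B; exact ContinuousLinearMapWOT.ofCLM_injective.eq_iff.symm
        rw [this]
        exact isClosed_eq (continuous_mul_const _) continuous_id
    exact hD hB
  · rintro ⟨hB, -, hBP⟩
    refine NonUnitalStarAlgebra.mem_sInf.2 fun A hA => ?_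
    refine toCLM_mem_of_forall_finset (A := (A : Set (K →L[ℂ] K))) hA.2 fun F ε hε => ?_
    obtain ⟨B', hB', h⟩ := exists_mem_span_approx hX hΩ hΩX hB hBP F hε
    refine ⟨B', ?_, h⟩
    have : Submodule.span ℂ Ω ≤ A.toNonUnitalSubalgebra.toSubmodule := Submodule.span_le.2 hA.1
    exact this hB'

/-- The commutant of `X` is self-adjoint and commutes with `Ω`, so it preserves the common kernel
and, through adjoints, its orthogonal complement. -/
theorem starProjection_supportSubspace_mem_centralizer (hX : ∀ s ∈ X, star s ∈ X)
    (hΩX : Ω ⊆ X.centralizer.centralizer) :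
    (supportSubspace Ω).starProjection ∈ X.centralizer.centralizer := by
  intro Y hY
  have hX' : ∀ s ∈ X.centralizer, star s ∈ X.centralizer :=
    fun s hs => Set.star_mem_centralizer' hX hs
  refine starProjection_mem_centralizer hX' _ (fun s hs w hw => ?_) Y hY
  rw [supportSubspace, Submodule.mem_orthogonal] at hw ⊢
  intro z hz
  rw [← ContinuousLinearMap.adjoint_inner_left]
  refine hw _ ?_
  simp only [Submodule.mem_iInf] at hz ⊢
  intro V hV
  have h := DFunLike.congr_fun (hΩX hV _ (hX' s hs)) z
  have hz' : V z = 0 := hz V hV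
  simp only [mul_apply_eq_comp, hz', map_zero] at h
  exact h.symm

theorem isUnitOf_weakAlgebra (hX : ∀ s ∈ X, star s ∈ X)
    (hcomm : ∀ s ∈ X, ∀ t ∈ X, s * t = t * s) (hΩ : ∀ s ∈ X, ∀ V ∈ Ω, s * V ∈ Ω)
    (hΩX : Ω ⊆ X.centralizer.centralizer) :
    IsUnitOf (supportSubspace Ω).starProjection (weakAlgebra Ω) := by
  have hidem : (supportSubspace Ω).starProjection * (supportSubspace Ω).starProjection =
      (supportSubspace Ω).starProjection :=
    (isStarProjection_starProjection (U := supportSubspace Ω)).isIdempotentElem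
  exact ⟨(mem_weakAlgebra_iff hX hcomm hΩ hΩX).2
    ⟨starProjection_supportSubspace_mem_centralizer hX hΩX, hidem, hidem⟩,
    fun B hB => ((mem_weakAlgebra_iff hX hcomm hΩ hΩX).1 hB).2⟩

/-- The residual argument for `Ω` extends to `B`: as `B = B P`, it kills `x - E x`, so `B x = B (E
x) = E (B x)`. -/
theorem apply_mem_closedOrbitSpan_of_mem_weakAlgebra (hX : ∀ s ∈ X, star s ∈ X)
    (hcomm : ∀ s ∈ X, ∀ t ∈ X, s * t = t * s) (hΩ : ∀ s ∈ X, ∀ V ∈ Ω, s * V ∈ Ω)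
    (hΩX : Ω ⊆ X.centralizer.centralizer) {B : K →L[ℂ] K} (hB : B ∈ weakAlgebra Ω) (x : K) :
    B x ∈ closedOrbitSpan Ω x := by
  obtain ⟨hB, -, hBP⟩ := (mem_weakAlgebra_iff hX hcomm hΩ hΩX).1 hB
  have h1 : x - (closedOrbitSpan Ω x).starProjection x ∈ (supportSubspace Ω)ᗮ :=
    mem_orthogonal_supportSubspace.2
      fun V hV => apply_sub_starProjection_closedOrbitSpan hX hΩ hΩX x hV
  have h2 : B (x - (closedOrbitSpan Ω x).starProjection x) = 0 := by
    rw [← hBP, mul_apply_eq_comp, (Submodule.starProjection_apply_eq_zero_iff _).2 h1, map_zero]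
  rw [map_sub, sub_eq_zero] at h2
  have h3 := DFunLike.congr_fun
    (hB _ (starProjection_closedOrbitSpan_mem_centralizer hX hΩ x)) x
  rw [h2]
  simp only [mul_apply_eq_comp] at h3
  rw [← h3]
  exact Submodule.starProjection_apply_mem _ _

end LimitAlgebra

/-! ### Limit operators of unitary groups -/

section UnitaryGroups

variable {K : Type*} [NormedAddCommGroup K] [InnerProductSpace ℂ K]

theorem limitOperators_subset_centralizer_centralizer {ι : Type*} [Preorder ι]
    {S : ι → K →L[ℂ] K} (m : LimitKind) :
    limitOperators S m ⊆ (Set.range S).centralizer.centralizer := fun _ hV =>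
  limitOperators_subset_of_isClosed
    (isClosed_setOf_toCLM_mem_centralizer (Set.range S).centralizer)
    (fun t => Set.subset_centralizer_centralizer ⟨t, rfl⟩) m hV

theorem Entangled.symm {ι κ : Type*} [Preorder ι] [Preorder κ] {S : ι → K →L[ℂ] K}
    {R : κ → K →L[ℂ] K} {m : LimitKind} (h : Entangled S R m) : Entangled R S m :=
  fun x => (h x).symm

theorem weaklyPoissonRecurrent_subset_of_entangled {ι κ : Type*} [Preorder ι] [Preorder κ]
    {S : ι → K →L[ℂ] K} {R : κ → K →L[ℂ] K} {m : LimitKind} (h : Entangled S R m) :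
    weaklyPoissonRecurrent S m ⊆ weaklyPoissonRecurrent R m := fun x hx =>
  closedOrbitSpan_le (Submodule.isClosed_topologicalClosure _) (h x).1 hx

variable [CompleteSpace K]

/-- A family of operators that represents an additive group by unitary operators. -/
structure IsUnitaryGroup {G : Type*} [AddCommGroup G] (S : G → K →L[ℂ] K) : Prop where
  map_zero : S 0 = 1
  map_add : ∀ s t, S (s + t) = S s * S t
  star_map : ∀ t, star (S t) = S (-t)

variable {G : Type*} [AddCommGroup G] {S : G → K →L[ℂ] K}

theorem IsUnitaryGroup.star_mem_range (h : IsUnitaryGroup S) :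
    ∀ s ∈ Set.range S, star s ∈ Set.range S := by
  rintro _ ⟨t, rfl⟩
  exact ⟨-t, (h.star_map t).symm⟩

theorem IsUnitaryGroup.mul_comm (h : IsUnitaryGroup S) :
    ∀ s ∈ Set.range S, ∀ t ∈ Set.range S, s * t = t * s := by
  rintro _ ⟨s, rfl⟩ _ ⟨t, rfl⟩
  rw [← h.map_add, ← h.map_add, add_comm]

variable [LinearOrder G] [IsOrderedAddMonoid G] (m : LimitKind)

/-- Left multiplication by `S s` is weakly continuous and turns `S t` into `S (s + t)`, and the
shifted times still increase or tend to `+∞`. -/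
theorem IsUnitaryGroup.mul_mem_limitOperators (h : IsUnitaryGroup S) :
    ∀ s ∈ Set.range S, ∀ V ∈ limitOperators S m, s * V ∈ limitOperators S m := by
  rintro _ ⟨s, rfl⟩ V hV
  have hcont : Continuous fun B : K →WOT[ℂ] K => ContinuousLinearMapWOT.ofCLM (S s) * B :=
    continuous_const_mul _
  cases m with
  | sequences =>
    obtain ⟨t, hmono, htop, ht⟩ := hV
    refine ⟨fun k => s + t k, fun i j hij => add_le_add_right (hmono hij) s,
      tendsto_atTop_add_const_left _ _ htop, ?_⟩
    refine ((hcont.tendsto _).comp ht).congr fun k => ?_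
    rw [h.map_add]
    rfl
  | nets =>
    have hV : MapClusterPt (ContinuousLinearMapWOT.ofCLM V) atTop
      fun t => ContinuousLinearMapWOT.ofCLM (S t) := hV
    have h1 := hV.continuousAt_comp hcont.continuousAt
    have h2 : MapClusterPt (ContinuousLinearMapWOT.ofCLM (S s * V)) atTop
        ((fun t => ContinuousLinearMapWOT.ofCLM (S t)) ∘ fun t => s + t) := by
      have h3 : ((fun t => ContinuousLinearMapWOT.ofCLM (S t)) ∘ fun t => s + t) =
          (fun B : K →WOT[ℂ] K => ContinuousLinearMapWOT.ofCLM (S s) * B) ∘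
            fun t => ContinuousLinearMapWOT.ofCLM (S t) := by
        funext t
        simp only [Function.comp_apply, h.map_add]
        rfl
      rw [h3]
      exact h1
    exact h2.of_comp (tendsto_atTop_add_const_left _ _ tendsto_id)

theorem IsUnitaryGroup.weaklyPoissonRecurrent_eq (h : IsUnitaryGroup S) :
    weaklyPoissonRecurrent S m = supportSubspace (limitOperators S m) := by
  ext x
  -- `limitSubspace` unfolds to `closedOrbitSpan` of the limit operators, just as `limitAlgebra`
  -- unfolds to `weakAlgebra`.
  exact mem_closedOrbitSpan_self_iff h.star_mem_range h.mul_comm (h.mul_mem_limitOperators m)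
    (limitOperators_subset_centralizer_centralizer m) x

theorem IsUnitaryGroup.exists_projection (h : IsUnitaryGroup S) :
    ∃ P, IsOrthogonalProjectionOnto P (weaklyPoissonRecurrent S m) ∧
      IsUnitOf P (limitAlgebra S m) := by
  refine ⟨(supportSubspace (limitOperators S m)).starProjection,
    ⟨isStarProjection_starProjection, ?_⟩,
    isUnitOf_weakAlgebra h.star_mem_range h.mul_comm (h.mul_mem_limitOperators m)
      (limitOperators_subset_centralizer_centralizer m)⟩
  rw [h.weaklyPoissonRecurrent_eq]
  exact congrArg SetLike.coe (Submodule.range_starProjection _)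

theorem IsUnitaryGroup.apply_mem_limitSubspace (h : IsUnitaryGroup S) {B : K →L[ℂ] K}
    (hB : B ∈ limitAlgebra S m) (x : K) : B x ∈ limitSubspace S m x :=
  apply_mem_closedOrbitSpan_of_mem_weakAlgebra h.star_mem_range h.mul_comm
    (h.mul_mem_limitOperators m) (limitOperators_subset_centralizer_centralizer m) hB x

theorem limitOperators_subset_limitAlgebra {ι : Type*} [Preorder ι] (S : ι → K →L[ℂ] K)
    (m : LimitKind) : limitOperators S m ⊆ limitAlgebra S m := fun _ hV =>
  NonUnitalStarAlgebra.mem_sInf.2 fun _ hA => hA.1 hV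

/-- Two unitary groups with the same commutant: entanglement, a common limit algebra and common
recurrent vectors are equivalent. -/
theorem tfae_of_centralizer_eq {G' : Type*} [AddCommGroup G'] [LinearOrder G']
    [IsOrderedAddMonoid G'] {R : G' → K →L[ℂ] K} (hS : IsUnitaryGroup S) (hR : IsUnitaryGroup R)
    (hSR : (Set.range S).centralizer = (Set.range R).centralizer) :
    List.TFAE [
      Entangled S R m,
      limitAlgebra S m = limitAlgebra R m ∧
        ∃ P, IsOrthogonalProjectionOnto P (weaklyPoissonRecurrent S m) ∧
          IsUnitOf P (limitAlgebra S m),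
      weaklyPoissonRecurrent R m = weaklyPoissonRecurrent S m] := by
  tfae_have 1 → 3 := fun h => (weaklyPoissonRecurrent_subset_of_entangled h.symm).antisymm
    (weaklyPoissonRecurrent_subset_of_entangled h)
  tfae_have 3 → 2 := by
    intro h
    refine ⟨?_, hS.exists_projection m⟩
    rw [hS.weaklyPoissonRecurrent_eq, hR.weaklyPoissonRecurrent_eq] at h
    ext B
    refine (mem_weakAlgebra_iff hS.star_mem_range hS.mul_comm (hS.mul_mem_limitOperators m)
      (limitOperators_subset_centralizer_centralizer m)).trans (Iff.trans ?_
      (mem_weakAlgebra_iff hR.star_mem_range hR.mul_comm (hR.mul_mem_limitOperators m)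
        (limitOperators_subset_centralizer_centralizer m)).symm)
    -- Both algebras are now corners of the same bicommutant, and `h` identifies the two support
    -- projections.
    rw [hSR]
    simp only [SetLike.coe_injective h]
  tfae_have 2 → 1 := by
    rintro ⟨h, -⟩ x
    refine ⟨fun V hV => hR.apply_mem_limitSubspace m ?_ x,
      fun V hV => hS.apply_mem_limitSubspace m ?_ x⟩
    · rw [← h]
      exact limitOperators_subset_limitAlgebra S m hV
    · rw [h]
      exact limitOperators_subset_limitAlgebra R m hV
  tfae_finish

end UnitaryGroups

/-! ### The resolvent, the cogenerator and their commutants -/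

namespace ContractionSemigroup

section Laplace

variable {K : Type*} [NormedAddCommGroup K] [InnerProductSpace ℂ K]
  (T : ContractionSemigroup K)

theorem op_comm (s t : ℝ≥0) : Commute (T.op s) (T.op t) := by
  rw [commute_iff_eq, ← T.op_add, ← T.op_add, add_comm]

/-- The generator of a semigroup of isometries is skew. -/
theorem GenMapsTo.re_inner_eq_zero {T : ContractionSemigroup K} (hT : ∀ t x, ‖T.op t x‖ = ‖x‖) {x y : K}
    (h : T.GenMapsTo x y) : (inner ℂ x y).re = 0 := by
  have h1 : Tendsto (fun t : ℝ => (inner ℂ x (t⁻¹ • (T.op t.toNNReal x - x))).re) (𝓝[>] 0)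
      (𝓝 (inner ℂ x y).re) :=
    (Complex.continuous_re.tendsto _).comp (tendsto_const_nhds.inner h)
  -- From `‖T_t x‖ = ‖x‖`, the real part of `⟨x, T_t x - x⟩` is `-‖T_t x - x‖² / 2`; dividing by `t`
  -- gives this expression, which tends to `0`.
  have h2 : Tendsto (fun t : ℝ => -(t / 2) * ‖t⁻¹ • (T.op t.toNNReal x - x)‖ ^ 2) (𝓝[>] 0)
      (𝓝 (-(0 / 2) * ‖y‖ ^ 2)) := by
    refine Tendsto.mul ?_ (h.norm.pow 2)
    exact ((continuous_id.div_const 2).neg.tendsto 0).mono_left nhdsWithin_le_nhds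
  refine (tendsto_nhds_unique h1 (h2.congr' ?_)).trans (by simp)
  filter_upwards [self_mem_nhdsWithin] with t ht
  have ht : (0 : ℝ) < t := ht
  have h3 := norm_add_sq (𝕜 := ℂ) x (T.op t.toNNReal x - x)
  rw [add_sub_cancel, hT] at h3
  have h4 : (inner ℂ x (T.op t.toNNReal x - x)).re = -‖T.op t.toNNReal x - x‖ ^ 2 / 2 := by
    simp only [RCLike.re_to_complex] at h3
    linarith
  rw [← Complex.coe_smul, inner_smul_right, Complex.re_ofReal_mul, h4, Complex.coe_smul,
    norm_smul, Real.norm_of_nonneg (inv_nonneg.2 ht.le)]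
  field_simp

variable [CompleteSpace K]

theorem commute_laplace_of_commute_op {X : K →L[ℂ] K} (h : ∀ t, Commute X (T.op t)) :
    Commute X T.laplace := by
  ext x
  have h' : ∀ t y, X (T.op t y) = T.op t (X y) := fun t => DFunLike.congr_fun (h t).eq
  simp only [mul_apply_eq_comp, laplace_apply]
  rw [← ContinuousLinearMap.integral_comp_comm _ (T.integrableOn_laplace x 0)]
  refine setIntegral_congr_fun measurableSet_Ioi fun t _ => ?_
  rw [← Complex.coe_smul, map_smul, Complex.coe_smul, h']

/-- The generator sends `L x` to `L x - x`; if `L x = 0`, it sends `0` to `-x`. -/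
theorem eq_zero_of_laplace_eq_zero {x : K} (h : T.laplace x = 0) : x = 0 := by
  have h1 := T.genMapsTo_laplace x
  rw [h] at h1
  have h2 : T.GenMapsTo (0 : K) 0 := by simp [GenMapsTo]
  have h3 := tendsto_nhds_unique h1 h2
  simpa using h3

theorem op_laplace (x : K) {h : ℝ} (hh : 0 ≤ h) :
    T.op h.toNNReal (T.laplace x) =
      Real.exp h • (T.laplace x - ∫ t in (0 : ℝ)..h, Real.exp (-t) • T.op t.toNNReal x) := by
  set g : ℝ → K := fun t => Real.exp (-t) • T.op t.toNNReal x with hg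
  have e1 : T.laplace x - ∫ t in (0 : ℝ)..h, g t = ∫ t in Set.Ioi h, g t := by
    rw [sub_eq_iff_eq_add, laplace_apply, add_comm,
      intervalIntegral.integral_interval_add_Ioi (T.integrableOn_laplace x 0)
        (T.integrableOn_laplace x h)]
  have e2 : ∫ t in Set.Ioi h, g t = ∫ t in Set.Ioi (0 : ℝ), g (t + h) := by
    have := (measurePreserving_add_right volume h).setIntegral_preimage_emb
      (measurableEmbedding_addRight h) g (Set.Ioi h)
    rw [← this]
    simp
  rw [e1, e2, laplace_apply, ← ContinuousLinearMap.integral_comp_comm _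
    (T.integrableOn_laplace x 0), ← integral_smul]
  refine setIntegral_congr_fun measurableSet_Ioi fun t ht => ?_
  have ht' : (0 : ℝ) ≤ t := le_of_lt ht
  simp only [hg]
  rw [smul_smul, ← Real.exp_add, Real.toNNReal_add ht' hh, add_comm t.toNNReal,
    T.op_add_apply, ← Complex.coe_smul, map_smul, Complex.coe_smul]
  congr 2
  ring

/-- The formula of `op_laplace`, which makes sense for all real `t`, solves `f' = f - T_t x`. -/
theorem hasDerivAt_exp_smul_laplace_sub (x : K) (t : ℝ) :
    HasDerivAt (fun h : ℝ => Real.exp h •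
      (T.laplace x - ∫ s in (0 : ℝ)..h, Real.exp (-s) • T.op s.toNNReal x))
      (Real.exp t • (T.laplace x - ∫ s in (0 : ℝ)..t, Real.exp (-s) • T.op s.toNNReal x) -
        T.op t.toNNReal x) t := by
  have hc : Continuous fun t : ℝ => Real.exp (-t) • T.op t.toNNReal x :=
    (by fun_prop : Continuous fun t : ℝ => Real.exp (-t)).smul
      ((T.continuous_orbit x).comp continuous_real_toNNReal)
  have h1 : HasDerivAt
      (fun h : ℝ => T.laplace x - ∫ s in (0 : ℝ)..h, Real.exp (-s) • T.op s.toNNReal x)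
      (-(Real.exp (-t) • T.op t.toNNReal x)) t :=
    (intervalIntegral.integral_hasDerivAt_right (hc.intervalIntegrable _ _)
      hc.stronglyMeasurable.stronglyMeasurableAtFilter hc.continuousAt).const_sub _
  refine ((Real.hasDerivAt_exp t).smul h1).congr_deriv ?_
  rw [smul_neg, smul_smul, ← Real.exp_add, add_neg_cancel, Real.exp_zero, one_smul]
  abel

variable {T}

theorem re_inner_laplace (hT : ∀ t x, ‖T.op t x‖ = ‖x‖) (x : K) :
    (inner ℂ (T.laplace x) (T.laplace x - x)).re = 0 :=
  (T.genMapsTo_laplace x).re_inner_eq_zero hT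

/-- With `y = L x`, the vectors `x` and its image are the sum and the difference of `x - y` and `y`,
whose inner product has real part zero because the generator is skew. -/
theorem norm_cogenerator_apply (hT : ∀ t x, ‖T.op t x‖ = ‖x‖) (x : K) :
    ‖T.cogenerator x‖ = ‖x‖ := by
  have h1 := re_inner_laplace hT x
  set y := T.laplace x with hy
  have h2 : T.cogenerator x = (x - y) - y := by
    rw [cogenerator_apply, two_smul]; abel
  have h3 : x = (x - y) + y := by abel
  have h4 : (inner ℂ (x - y) y).re = 0 := by
    rw [← inner_conj_symm, Complex.conj_re, ← neg_sub y x, inner_neg_right, Complex.neg_re, h1,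
      neg_zero]
  have h5 := norm_sub_sq (𝕜 := ℂ) (x - y) y
  have h6 := norm_add_sq (𝕜 := ℂ) (x - y) y
  rw [← h2] at h5
  rw [← h3] at h6
  simp only [RCLike.re_to_complex, h4] at h5 h6
  rw [← sq_eq_sq₀ (norm_nonneg _) (norm_nonneg _), h5, h6]
  ring

/-- An operator that commutes with the resolvent of a semigroup of isometries commutes with the
semigroup. -/
theorem commute_op_of_commute_laplace (hT : ∀ t x, ‖T.op t x‖ = ‖x‖) {X : K →L[ℂ] K}
    (hX : Commute X T.laplace) (t : ℝ≥0) : Commute X (T.op t) := by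
  have hX' : ∀ y, X (T.laplace y) = T.laplace (X y) := DFunLike.congr_fun hX.eq
  have hL : ∀ t y, T.op t (T.laplace y) = T.laplace (T.op t y) := fun t =>
    DFunLike.congr_fun (T.commute_laplace_of_commute_op (T.op_comm t)).eq
  ext z
  -- `F z` extends the orbit of `L z` to negative times, so that two-sided derivatives exist at `0`
  -- as well.
  set F : K → ℝ → K := fun z h => Real.exp h •
    (T.laplace z - ∫ s in (0 : ℝ)..h, Real.exp (-s) • T.op s.toNNReal z) with hF
  have hFop : ∀ z {h : ℝ}, 0 ≤ h → F z h = T.op h.toNNReal (T.laplace z) :=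
    fun z h hh => (T.op_laplace z hh).symm
  set u : ℝ → K := fun h => X (T.op h.toNNReal z) - T.op h.toNNReal (X z) with hu
  set v : ℝ → K := fun h => X (F z h) - F (X z) h with hv
  have hvu : ∀ {h : ℝ}, 0 ≤ h → v h = T.laplace (u h) := by
    intro h hh
    simp only [hv, hu, hFop _ hh, map_sub, hL, hX']
  have hdv : ∀ h, HasDerivAt v (v h - u h) h := by
    intro h
    have h1 := ((X.restrictScalars ℝ).hasFDerivAt.comp_hasDerivAt h
      (T.hasDerivAt_exp_smul_laplace_sub z h)).sub (T.hasDerivAt_exp_smul_laplace_sub (X z) h)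
    refine h1.congr_deriv ?_
    simp only [hv, hu, hF, ContinuousLinearMap.coe_restrictScalars', map_sub]
    abel
  -- Energy argument: `v = L u` and `v' = v - u`, and skewness makes `v - u` orthogonal to `v` in
  -- real part. So `‖v‖²` keeps its initial value `0`, and injectivity of `L` gives `u = 0`.
  have hconst := constant_of_has_deriv_right_zero (f := fun h => inner ℂ (v h) (v h))
    (a := 0) (b := t)
    (fun h _ => ((hdv h).inner ℂ (hdv h)).continuousAt.continuousWithinAt) (fun h hh => by
      have h1 := (hdv h).inner ℂ (hdv h)
      refine (h1.congr_deriv ?_).hasDerivWithinAt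
      have h2 : (inner ℂ (v h) (v h - u h)).re = 0 := by
        rw [hvu hh.1]
        exact re_inner_laplace hT (u h)
      rw [← inner_conj_symm (v h - u h) (v h), Complex.add_conj, h2]
      simp) t ⟨t.2, le_rfl⟩
  have hv0 : v 0 = 0 := by
    rw [hvu le_rfl]
    simp [hu, T.op_zero]
  simp only [hv0, inner_zero_left] at hconst
  have h1 : u t = 0 := T.eq_zero_of_laplace_eq_zero (by
    rw [← hvu t.coe_nonneg]
    exact inner_self_eq_zero.1 hconst)
  simp only [hu, Real.toNNReal_coe] at h1
  exact sub_eq_zero.1 h1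

theorem cogenerator_eq : T.cogenerator = 1 - (2 : ℂ) • T.laplace := by
  ext x
  exact T.cogenerator_apply x

/-- The commutant of the cogenerator of an isometric semigroup is that of the semigroup. -/
theorem commute_cogenerator_iff (hT : ∀ t x, ‖T.op t x‖ = ‖x‖) {X : K →L[ℂ] K} :
    Commute X T.cogenerator ↔ ∀ t, Commute X (T.op t) := by
  constructor
  · intro h
    have h1 : T.laplace = (2⁻¹ : ℂ) • (1 - T.cogenerator) := by
      rw [cogenerator_eq, sub_sub_cancel, smul_smul, inv_mul_cancel₀ two_ne_zero, one_smul]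
    refine commute_op_of_commute_laplace hT ?_
    rw [h1]
    exact ((Commute.one_right X).sub_right h).smul_right _
  · intro h
    rw [cogenerator_eq]
    exact (Commute.one_right X).sub_right ((T.commute_laplace_of_commute_op h).smul_right _)

theorem commute_star_op (hU : ∀ t, T.op t ∈ unitary (K →L[ℂ] K)) {X : K →L[ℂ] K} {t : ℝ≥0}
    (h : Commute X (T.op t)) : Commute X (star (T.op t)) :=
  Commute.units_inv_right (u := Unitary.toUnits (⟨_, hU t⟩ : unitary (K →L[ℂ] K))) h

/-- The cogenerator is isometric. Its adjoint commutes with the semigroup, hence with the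
cogenerator itself, so the left inverse is also a right inverse. -/
theorem cogenerator_mem_unitary (hU : ∀ t, T.op t ∈ unitary (K →L[ℂ] K)) :
    T.cogenerator ∈ unitary (K →L[ℂ] K) := by
  have hT : ∀ t x, ‖T.op t x‖ = ‖x‖ := fun t =>
    (ContinuousLinearMap.norm_map_iff_adjoint_comp_self _).2 (Unitary.mem_iff.1 (hU t)).1
  have h1 : star T.cogenerator * T.cogenerator = 1 :=
    (ContinuousLinearMap.norm_map_iff_adjoint_comp_self _).1 (norm_cogenerator_apply hT)
  have h2 : ∀ t, Commute (star T.cogenerator) (T.op t) := fun t =>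
    commute_star_comm.2 (commute_star_op hU
      ((commute_cogenerator_iff hT).2 fun s => T.op_comm t s).symm)
  exact Unitary.mem_iff.2 ⟨h1, ((commute_cogenerator_iff hT).2 h2).eq ▸ h1⟩

end Laplace

end ContractionSemigroup

/-! ### The groups on the unitary subspace -/

namespace ContractionSemigroup

variable {H : Type*} [NormedAddCommGroup H] [InnerProductSpace ℂ H] [CompleteSpace H]
  (T : ContractionSemigroup H)

@[simp]
theorem coe_unitaryPart_apply (t : ℝ≥0) (x : T.unitarySubspace) :
    (T.unitaryPart t x : H) = T.op t x := rfl

theorem norm_unitaryPart_apply (t : ℝ≥0) (x : T.unitarySubspace) : ‖T.unitaryPart t x‖ = ‖x‖ :=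
  (x.2 t).1

/-- The restriction of a contraction semigroup to its unitary subspace. -/
noncomputable def unitaryRestriction : ContractionSemigroup T.unitarySubspace where
  op := T.unitaryPart
  op_zero := by ext x; simp [T.op_zero]
  op_add s t := by ext x; simp [T.op_add_apply]
  norm_le t := ContinuousLinearMap.opNorm_le_bound _ zero_le_one fun x => by
    rw [one_mul, norm_unitaryPart_apply]
  continuous_orbit x := (T.continuous_orbit x).subtype_mk _

theorem norm_unitaryRestriction_op_apply (t : ℝ≥0) (x : T.unitarySubspace) :
    ‖T.unitaryRestriction.op t x‖ = ‖x‖ := T.norm_unitaryPart_apply t x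

theorem coe_laplace_unitaryRestriction (x : T.unitarySubspace) :
    (T.unitaryRestriction.laplace x : H) = T.laplace x := by
  have h := T.unitarySubspace.subtypeL.integral_comp_comm
    (T.unitaryRestriction.integrableOn_laplace x 0)
  exact h.symm

theorem cogenerator_unitaryRestriction :
    T.unitaryRestriction.cogenerator = T.cogeneratorUnitaryPart := by
  ext x
  rw [cogenerator_apply]
  change ((x : H) - (2 : ℂ) • (T.unitaryRestriction.laplace x : H)) = T.cogenerator x
  rw [coe_laplace_unitaryRestriction, cogenerator_apply]

/-- Invariance under the adjoints makes the restricted operators surjective. It rests on `T_a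
T_{b+a}* x = T_b* x`, which holds because `T_a*` preserves the norm of `T_b* x`. -/
theorem adjoint_op_mem_unitarySubspace (s : ℝ≥0) {x : H} (hx : x ∈ T.unitarySubspace) :
    (T.op s).adjoint x ∈ T.unitarySubspace := by
  have hadd : ∀ a b y, (T.op (a + b)).adjoint y = (T.op b).adjoint ((T.op a).adjoint y) := by
    intro a b y
    rw [T.op_add]
    exact DFunLike.congr_fun (ContinuousLinearMap.adjoint_comp (T.op a) (T.op b)) y
  have key : ∀ a b, T.op a ((T.op (b + a)).adjoint x) = (T.op b).adjoint x := by
    intro a b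
    have h1 : ‖(T.op a).adjoint ((T.op b).adjoint x)‖ = ‖(T.op b).adjoint x‖ := by
      rw [← hadd, (hx _).2, (hx _).2]
    have h2 := (norm_eq_iff_adjoint (T.norm_adjoint_op_le a) _).1 h1
    rwa [ContinuousLinearMap.adjoint_adjoint, ← hadd] at h2
  intro t
  refine ⟨?_, by rw [← hadd, (hx _).2, (hx _).2]⟩
  rw [(hx s).2]
  rcases le_total t s with h | h
  · obtain ⟨r, rfl⟩ := exists_add_of_le h
    rw [add_comm t r, key, (hx r).2]
  · obtain ⟨r, rfl⟩ := exists_add_of_le h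
    have h1 := key s 0
    rw [zero_add, T.op_zero] at h1
    have h2 : (T.op s) ((T.op s).adjoint x) = x := by
      rw [h1]
      change star (1 : H →L[ℂ] H) x = x
      rw [star_one]
      rfl
    rw [add_comm s r, T.op_add_apply, h2, (hx r).1]

theorem unitaryPart_mem_unitary (t : ℝ≥0) :
    T.unitaryPart t ∈ unitary (T.unitarySubspace →L[ℂ] T.unitarySubspace) := by
  have h1 : star (T.unitaryPart t) * T.unitaryPart t = 1 :=
    (ContinuousLinearMap.norm_map_iff_adjoint_comp_self _).1 (T.norm_unitaryPart_apply t)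
  refine Unitary.mem_iff.2 ⟨h1, ?_⟩
  ext y
  obtain ⟨x, hx⟩ : ∃ x, T.unitaryPart t x = y :=
    ⟨⟨_, T.adjoint_op_mem_unitarySubspace t y.2⟩,
      Subtype.ext ((T.norm_and_norm_iff t (y : H)).1 (y.2 t)).2⟩
  have h2 := DFunLike.congr_fun h1 x
  simp only [mul_apply_eq_comp, one_apply_eq_self, hx] at h2
  simp only [mul_apply_eq_comp, one_apply_eq_self, h2, hx]

theorem unitaryPart_add (s t : ℝ≥0) :
    T.unitaryPart (s + t) = T.unitaryPart s * T.unitaryPart t := T.unitaryRestriction.op_add s t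

/-- One formula for all signs: writing real times as differences yields the group laws without case
distinctions. -/
theorem unitaryGroup_coe_sub_coe (a b : ℝ≥0) :
    T.unitaryGroup ((a : ℝ) - b) = T.unitaryPart a * star (T.unitaryPart b) := by
  unfold unitaryGroup
  split_ifs with h
  · obtain ⟨c, rfl⟩ := exists_add_of_le (NNReal.coe_le_coe.1 (sub_nonneg.1 h))
    rw [NNReal.coe_add, add_sub_cancel_left, Real.toNNReal_coe, add_comm, unitaryPart_add,
      mul_assoc, (Unitary.mem_iff.1 (T.unitaryPart_mem_unitary b)).2, mul_one]
  · obtain ⟨c, rfl⟩ := exists_add_of_le (NNReal.coe_le_coe.1 (sub_nonpos.1 (not_le.1 h).le))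
    rw [NNReal.coe_add, neg_sub, add_sub_cancel_left, Real.toNNReal_coe, add_comm,
      unitaryPart_add, star_mul (T.unitaryPart c) (T.unitaryPart a), ← mul_assoc,
      (Unitary.mem_iff.1 (T.unitaryPart_mem_unitary a)).2, one_mul]
    rfl

theorem commute_star_unitaryPart {X : T.unitarySubspace →L[ℂ] T.unitarySubspace} {t : ℝ≥0}
    (h : Commute X (T.unitaryPart t)) : Commute X (star (T.unitaryPart t)) :=
  commute_star_op (T := T.unitaryRestriction) T.unitaryPart_mem_unitary h

theorem commute_unitaryPart (s t : ℝ≥0) : Commute (T.unitaryPart s) (T.unitaryPart t) :=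
  T.unitaryRestriction.op_comm s t

theorem exists_eq_coe_sub_coe (t : ℝ) : ∃ a b : ℝ≥0, t = a - b :=
  ⟨t.toNNReal, (-t).toNNReal, by simp⟩

theorem isUnitaryGroup_unitaryGroup : IsUnitaryGroup T.unitaryGroup where
  map_zero := by
    have := T.unitaryGroup_coe_sub_coe 0 0
    rwa [(Unitary.mem_iff.1 (T.unitaryPart_mem_unitary 0)).2, sub_self] at this
  map_add s t := by
    obtain ⟨a, b, rfl⟩ := exists_eq_coe_sub_coe s
    obtain ⟨c, d, rfl⟩ := exists_eq_coe_sub_coe t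
    have h : ((a : ℝ) - b) + (c - d) = ((a + c : ℝ≥0) : ℝ) - (d + b : ℝ≥0) := by
      push_cast; ring
    have hcb : star (T.unitaryPart b) * T.unitaryPart c = T.unitaryPart c * star (T.unitaryPart b) :=
      (T.commute_star_unitaryPart (T.commute_unitaryPart c b)).symm.eq
    have hbd : star (T.unitaryPart d * T.unitaryPart b) =
        star (T.unitaryPart b) * star (T.unitaryPart d) :=
      star_mul (T.unitaryPart d) (T.unitaryPart b)
    rw [h, unitaryGroup_coe_sub_coe, unitaryGroup_coe_sub_coe, unitaryGroup_coe_sub_coe,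
      unitaryPart_add, unitaryPart_add, hbd]
    calc _ = T.unitaryPart a * (T.unitaryPart c * star (T.unitaryPart b)) *
          star (T.unitaryPart d) := by simp only [mul_assoc]
      _ = _ := by rw [← hcb]; simp only [mul_assoc]
  star_map t := by
    obtain ⟨a, b, rfl⟩ := exists_eq_coe_sub_coe t
    rw [neg_sub, unitaryGroup_coe_sub_coe, unitaryGroup_coe_sub_coe, star_mul, star_star]

theorem commute_cogeneratorUnitaryPart_iff
    {X : T.unitarySubspace →L[ℂ] T.unitarySubspace} :
    Commute X T.cogeneratorUnitaryPart ↔ ∀ t, Commute X (T.unitaryPart t) := by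
  rw [← cogenerator_unitaryRestriction]
  exact commute_cogenerator_iff T.norm_unitaryRestriction_op_apply

theorem cogeneratorUnitaryPart_mem_unitary :
    T.cogeneratorUnitaryPart ∈ unitary (T.unitarySubspace →L[ℂ] T.unitarySubspace) := by
  rw [← cogenerator_unitaryRestriction]
  exact cogenerator_mem_unitary T.unitaryPart_mem_unitary

theorem cogeneratorGroup_eq_zpow (n : ℤ) :
    T.cogeneratorGroup n = ((⟨_, T.cogeneratorUnitaryPart_mem_unitary⟩ ^ n :
      unitary (T.unitarySubspace →L[ℂ] T.unitarySubspace)) :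
        T.unitarySubspace →L[ℂ] T.unitarySubspace) := by
  unfold cogeneratorGroup
  split_ifs with h
  · obtain ⟨k, rfl⟩ := Int.eq_ofNat_of_zero_le h
    simp
  · obtain ⟨k, hk⟩ := Int.eq_ofNat_of_zero_le (neg_nonneg.2 (not_le.1 h).le)
    obtain rfl : n = -k := by omega
    rw [neg_neg, Int.toNat_natCast, zpow_neg, zpow_natCast, ← inv_pow]
    rfl

theorem isUnitaryGroup_cogeneratorGroup : IsUnitaryGroup T.cogeneratorGroup where
  map_zero := by rw [cogeneratorGroup_eq_zpow, zpow_zero]; rfl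
  map_add s t := by
    rw [cogeneratorGroup_eq_zpow, cogeneratorGroup_eq_zpow, cogeneratorGroup_eq_zpow, zpow_add]
    rfl
  star_map t := by
    rw [cogeneratorGroup_eq_zpow, cogeneratorGroup_eq_zpow, zpow_neg]
    rfl

/-- Commuting with a unitary entails commuting with its inverse, so each commutant is decided by the
forward semigroup or by the cogenerator, where `commute_cogeneratorUnitaryPart_iff` applies. -/
theorem centralizer_range_unitaryGroup :
    (Set.range T.unitaryGroup).centralizer = (Set.range T.cogeneratorGroup).centralizer := by
  ext X
  have hU : X ∈ (Set.range T.unitaryGroup).centralizer ↔ ∀ t, Commute X (T.unitaryPart t) := by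
    refine ⟨fun h t => ?_, ?_⟩
    · have h1 := h _ ⟨t, rfl⟩
      have h2 : T.unitaryGroup t = T.unitaryPart t := by simp [unitaryGroup]
      rw [h2] at h1
      exact h1.symm
    · rintro h _ ⟨t, rfl⟩
      obtain ⟨a, b, rfl⟩ := exists_eq_coe_sub_coe t
      rw [unitaryGroup_coe_sub_coe]
      exact ((h a).mul_right (T.commute_star_unitaryPart (h b))).symm.eq
  have hC : X ∈ (Set.range T.cogeneratorGroup).centralizer ↔
      Commute X T.cogeneratorUnitaryPart := by
    refine ⟨fun h => ?_, ?_⟩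
    · have h1 := h _ ⟨1, rfl⟩
      have h2 : T.cogeneratorGroup 1 = T.cogeneratorUnitaryPart := by simp [cogeneratorGroup]
      rw [h2] at h1
      exact h1.symm
    · rintro h _ ⟨n, rfl⟩
      rw [cogeneratorGroup_eq_zpow]
      have h1 : Commute X ((Unitary.toUnits ⟨_, T.cogeneratorUnitaryPart_mem_unitary⟩ :
        (T.unitarySubspace →L[ℂ] T.unitarySubspace)ˣ) :
          T.unitarySubspace →L[ℂ] T.unitarySubspace) := h
      have h2 := h1.units_zpow_right n
      rw [← map_zpow] at h2
      exact h2.symm.eq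
  rw [hU, hC, commute_cogeneratorUnitaryPart_iff]

end ContractionSemigroup

theorem theorem5p3 {H : Type*} [NormedAddCommGroup H] [InnerProductSpace ℂ H] [CompleteSpace H]
    (T : ContractionSemigroup H) (m : LimitKind) :
    -- each limit algebra has the projection onto the recurrent vectors as its unit
    (∃ P, IsOrthogonalProjectionOnto P (weaklyPoissonRecurrent T.unitaryGroup m) ∧
      IsUnitOf P (limitAlgebra T.unitaryGroup m)) ∧
    (∃ P, IsOrthogonalProjectionOnto P (weaklyPoissonRecurrent T.cogeneratorGroup m) ∧
      IsUnitOf P (limitAlgebra T.cogeneratorGroup m)) ∧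
    List.TFAE [
      Entangled T.unitaryGroup T.cogeneratorGroup m,
      limitAlgebra T.unitaryGroup m = limitAlgebra T.cogeneratorGroup m ∧
        ∃ P, IsOrthogonalProjectionOnto P (weaklyPoissonRecurrent T.unitaryGroup m) ∧
          IsUnitOf P (limitAlgebra T.unitaryGroup m),
      weaklyPoissonRecurrent T.cogeneratorGroup m = weaklyPoissonRecurrent T.unitaryGroup m] := by
  have hU := T.isUnitaryGroup_unitaryGroup
  have hC := T.isUnitaryGroup_cogeneratorGroup
  exact ⟨hU.exists_projection m, hC.exists_projection m,
    tfae_of_centralizer_eq m hU hC T.centralizer_range_unitaryGroup⟩
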